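/- Let $g$ be a smooth Riemannian metric on the torus $\mathbb T^n=\mathbb R^n/\mathbb Z^n$, lifted to a $\mathbb Z^n$-periodic Riemannian metric on the universal cover $\mathbb R^n$ (still denoted $g$). Let $d_g$ be its Riemannian distance on $\mathbb R^n$ and $\mu_g$ its Riemannian measure. For $\rho>0$ put $\delta_\rho(x)=\rho x$, $g_\rho=\rho^{-2}\,\delta_\rho^*g$, let $\mu_\rho$ be the Riemannian measure of $g_\rho$, and put $$d_\rho(x,y)=\frac{d_g(\rho x,\rho y)}{\rho},\qquad B_\rho(1)=\{x\in\mathbb R^n : d_\rho(0,x)\le 1\}.$$ A net $(X_\alpha,d_\alpha,m_\alpha)$ of compact metric spaces with finite Borel measures converges to $(X,d,m)$ in the measured Gromov–Hausdorff topology if there are positive numbers $\varepsilon_\alpha$ decreasing to $0$ and measurable maps $f_\alpha:X_\alpha\to X$ such that the $\varepsilon_\alpha$-neighbourhood of $f_\alpha(X_\alpha)$ is $X$, $|d_\alpha(x,y)-d(f_\alpha(x),f_\alpha(y))|\le\varepsilon_\alpha$ for all $x,y\in X_\alpha$, and $\int_{X_\alpha}u\circ f_\alpha\,dm_\alpha\to\int_X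 u\,dm$ for every continuous $u:X\to\mathbb R$. **Theorem.** There is a norm $\|\cdot\|_\infty$ on $\mathbb R^n$ (the stable norm of $g$) such that $$\lim_{\rho\to+\infty}\frac{d_g(0,\rho x)}{\rho}=\|x\|_\infty\qquad\text{for all }x\in\mathbb R^n,$$ and, with $B_\infty(1)=\{x\in\mathbb R^n:\|x\|_\infty\le1\}$ and $\mu_\infty$ the multiple of the Lebesgue measure such that $\mu_\infty(D)=\mu_g(D)$ for the fundamental domain $D=[0,1)^n$ of $\mathbb Z^n$, the net of measured metric spaces $(B_\rho(1),d_\rho,\mu_\rho)_{\rho>0}$ converges, as $\rho\to+\infty$, to $(B_\infty(1),\|x-y\|_\infty,\mu_\infty)$ in the measured Gromov–Hausdorff topology. -/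

import Mathlib

open MeasureTheory Filter Topology Set
open scoped Manifold ContDiff ENNReal Bundle

noncomputable section

/-! ### Measured Gromov-Hausdorff convergence -/

/-- A compact metric space with a finite Borel measure. -/
structure CompactMMSpace : Type 1 where
  carrier : Type
  [metricSpace : MetricSpace carrier]
  [compactSpace : CompactSpace carrier]
  [measurableSpace : MeasurableSpace carrier]
  [borelSpace : BorelSpace carrier]
  measure : Measure carrier
  [isFiniteMeasure : IsFiniteMeasure measure]

namespace CompactMMSpace

instance : CoeSort CompactMMSpace Type := ⟨carrier⟩

attribute [instance] metricSpace compactSpace measurableSpace borelSpace isFiniteMeasure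

end CompactMMSpace

/-- `φ : X → Y` is an `ε`-Hausdorff approximation: the `ε`-neighbourhood of `φ(X)` is `Y`, and `φ`
distorts distances by at most `ε`. -/
def IsHausdorffApprox {X Y : Type*} [MetricSpace X] [MetricSpace Y] (ε : ℝ) (φ : X → Y) : Prop :=
  Metric.thickening ε (range φ) = univ ∧
    ∀ x y : X, |dist x y - dist (φ x) (φ y)| ≤ ε

/-- Convergence of a net of compact metric measured spaces in the measured Gromov-Hausdorff
topology. -/
def MGHConverges {A : Type*} [Preorder A] [IsDirectedOrder A] [Nonempty A]
    (X : A → CompactMMSpace) (Y : CompactMMSpace) : Prop :=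
  ∃ (ε : A → ℝ) (f : ∀ a, X a → Y),
    (∀ a, 0 < ε a) ∧ Antitone ε ∧ Tendsto ε atTop (𝓝 0) ∧
    (∀ a, Measurable (f a)) ∧ (∀ a, IsHausdorffApprox (ε a) (f a)) ∧
    ∀ u : C(Y, ℝ), Tendsto (fun a => ∫ x, u (f a x) ∂(X a).measure) atTop
      (𝓝 (∫ y, u y ∂Y.measure))

/-! ### Closed balls of distances on `ℝⁿ` that are bi-Lipschitz to the Euclidean one -/

/-- The Euclidean space `ℝⁿ`. -/
abbrev Eucl (n : ℕ) : Type := EuclideanSpace ℝ (Fin n)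

/-- `d` is a distance on `ℝⁿ` that is bi-Lipschitz equivalent to the Euclidean distance. -/
structure IsBilipDist {n : ℕ} (d : Eucl n → Eucl n → ℝ) : Prop where
  self : ∀ x, d x x = 0
  comm : ∀ x y, d x y = d y x
  triangle : ∀ x y z, d x z ≤ d x y + d y z
  bilip : ∃ α β : ℝ, 0 < α ∧ 0 < β ∧ ∀ x y, α * ‖x - y‖ ≤ d x y ∧ d x y ≤ β * ‖x - y‖

namespace IsBilipDist

variable {n : ℕ} {d : Eucl n → Eucl n → ℝ}

/-- The metric space structure on `ℝⁿ` with distance `d` (and the usual topology). -/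
@[reducible] def metricSpace (hd : IsBilipDist d) : MetricSpace (Eucl n) :=
  MetricSpace.ofDistTopology d hd.self hd.comm hd.triangle
    (by
      obtain ⟨α, β, hα, hβ, h⟩ := hd.bilip
      intro s
      rw [Metric.isOpen_iff]
      refine forall₂_congr fun x _ => ⟨?_, ?_⟩
      · rintro ⟨ε, hε, hs⟩
        refine ⟨α * ε, by positivity, fun y hy => hs ?_⟩
        rw [Metric.mem_ball, dist_comm, dist_eq_norm]
        exact lt_of_mul_lt_mul_left ((h x y).1.trans_lt hy) hα.le
      · rintro ⟨ε, hε, hs⟩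
        refine ⟨ε / β, by positivity, fun y hy => hs y ((h x y).2.trans_lt ?_)⟩
        rw [Metric.mem_ball, dist_comm, dist_eq_norm, lt_div_iff₀ hβ] at hy
        linarith)
    (by
      obtain ⟨α, β, hα, hβ, h⟩ := hd.bilip
      intro x y hxy
      have h1 := (h x y).1
      rw [hxy] at h1
      have h2 : ‖x - y‖ ≤ 0 := by
        by_contra! hc
        nlinarith [mul_pos hα hc]
      exact sub_eq_zero.1 (norm_le_zero_iff.1 h2))

/-- The closed `d`-balls centred at the origin are compact. -/
lemma isCompact_ball (hd : IsBilipDist d) (R : ℝ) : IsCompact {x | d 0 x ≤ R} := by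
  obtain ⟨α, β, hα, hβ, h⟩ := hd.bilip
  have hc : Continuous fun x => d 0 x := by
    refine continuous_iff_continuousAt.2 fun x => ?_
    rw [Metric.continuousAt_iff]
    intro ε hε
    refine ⟨ε / β, by positivity, fun {y} hy => ?_⟩
    rw [dist_eq_norm, lt_div_iff₀ hβ] at hy
    have h1 := hd.triangle 0 x y
    have h2 := hd.triangle 0 y x
    have h3 := (h y x).2
    rw [Real.dist_eq, abs_lt]
    rw [hd.comm x y] at h1
    constructor <;> linarith
  refine (isCompact_closedBall (0 : Eucl n) (R / α)).of_isClosed_subset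
    (isClosed_le hc continuous_const) fun x hx => ?_
  have h1 := (h 0 x).1
  rw [zero_sub, norm_neg] at h1
  rw [mem_closedBall_zero_iff, le_div_iff₀ hα]
  have : d 0 x ≤ R := hx
  linarith

/-- The closed ball `{x | d(0, x) ≤ R}` with the distance `d` and the restriction of `μ`. -/
def closedBall (hd : IsBilipDist d) (μ : Measure (Eucl n)) [IsFiniteMeasureOnCompacts μ] (R : ℝ) :
    CompactMMSpace :=
  letI : MetricSpace {x : Eucl n // d 0 x ≤ R} :=
    @Subtype.metricSpace (Eucl n) (fun x => d 0 x ≤ R) hd.metricSpace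
  haveI : CompactSpace {x : Eucl n // d 0 x ≤ R} :=
    isCompact_iff_compactSpace.1 (hd.isCompact_ball R)
  haveI : BorelSpace {x : Eucl n // d 0 x ≤ R} :=
    Subtype.borelSpace {x : Eucl n | d 0 x ≤ R}
  haveI : IsFiniteMeasure (μ.comap ((↑) : {x : Eucl n // d 0 x ≤ R} → Eucl n)) := by
    refine ⟨?_⟩
    have := comap_subtype_coe_apply (hd.isCompact_ball R).measurableSet μ univ
    rw [image_univ, Subtype.range_coe] at this
    exact this.trans_lt (hd.isCompact_ball R).measure_lt_top
  { carrier := {x : Eucl n // d 0 x ≤ R}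
    measure := μ.comap (↑) }

end IsBilipDist

/-! ### Norms on `ℝⁿ` -/

/-- A norm on the vector space `ℝⁿ`. -/
structure VecNorm (n : ℕ) extends Seminorm ℝ (Eucl n) where
  eq_zero_of_map_eq_zero : ∀ x, toFun x = 0 → x = 0

namespace VecNorm

variable {n : ℕ}

instance : CoeFun (VecNorm n) fun _ => Eucl n → ℝ := ⟨fun N => N.toSeminorm⟩

lemma isBilipDist (N : VecNorm n) : IsBilipDist fun x y => N (x - y) where
  self x := by simp
  comm x y := map_sub_rev N.toSeminorm x y
  triangle x y z := by
    have := map_add_le_add N.toSeminorm (x - y) (y - z)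
    rwa [sub_add_sub_cancel] at this
  bilip := by
    obtain ⟨C, hC, hNC⟩ : ∃ C : ℝ, 0 < C ∧ ∀ x, N x ≤ C * ‖x‖ := by
      let b := (EuclideanSpace.basisFun (Fin n) ℝ).toBasis
      refine ⟨∑ i, N (b i) + 1, ?_, fun x => ?_⟩
      · have : 0 ≤ ∑ i, N (b i) := Finset.sum_nonneg fun i _ => apply_nonneg N.toSeminorm _
        linarith
      · calc N x = N (∑ i, b.repr x i • b i) := by rw [b.sum_repr]
          _ ≤ ∑ i, N (b.repr x i • b i) := Finset.le_sum_of_subadditive N.toSeminorm (map_zero N.toSeminorm).le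
            (map_add_le_add N.toSeminorm) _ _
          _ ≤ ∑ i, N (b i) * ‖x‖ := by
            refine Finset.sum_le_sum fun i _ => ?_
            rw [map_smul_eq_mul, mul_comm]
            refine mul_le_mul_of_nonneg_left ?_ (apply_nonneg N.toSeminorm _)
            simpa [b] using PiLp.norm_apply_le x i
          _ ≤ (∑ i, N (b i) + 1) * ‖x‖ := by
            rw [← Finset.sum_mul, add_mul]
            linarith [norm_nonneg x]
    have hc : Continuous N.toSeminorm := by
      refine (LipschitzWith.of_dist_le_mul (K := C.toNNReal) fun x y => ?_).continuous
      rw [Real.dist_eq, dist_eq_norm, Real.coe_toNNReal _ hC.le]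
      exact (abs_sub_map_le_sub N.toSeminorm x y).trans (hNC _)
    obtain ⟨a, ha, h1⟩ := (isCompact_sphere (0 : Eucl n) 1).exists_forall_le' hc.continuousOn
      (a := 0) (by
        intro v hv
        refine (apply_nonneg N.toSeminorm v).lt_of_ne fun h => ?_
        have : v = 0 := N.eq_zero_of_map_eq_zero v h.symm
        simp [this] at hv)
    refine ⟨a, C, ha, hC, fun x y => ⟨?_, hNC _⟩⟩
    rcases eq_or_ne (x - y) 0 with h | h
    · simp [h]
    have hv' : 0 < ‖x - y‖ := norm_pos_iff.2 h
    have h2 := h1 (‖x - y‖⁻¹ • (x - y)) (by simp [norm_smul, hv'.ne'])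
    rw [map_smul_eq_mul, norm_inv, norm_norm, ← div_eq_inv_mul, le_div_iff₀ hv'] at h2
    exact h2

/-- The closed ball of radius `R` of the norm `N`, with the distance `N (x - y)` and the restriction
of the measure `μ`. -/
def closedBall (N : VecNorm n) (μ : Measure (Eucl n)) [IsFiniteMeasureOnCompacts μ] (R : ℝ) :
    CompactMMSpace :=
  N.isBilipDist.closedBall μ R

end VecNorm

/-! ### Riemannian metrics on `ℝⁿ` -/

section Distance

variable {F : Type*} [NormedAddCommGroup F] [InnerProductSpace ℝ F]

variable (F) in
/-- Smooth Riemannian metrics on the manifold `F`, for a vector space `F`. -/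
abbrev SmoothMetric : Type _ :=
  Bundle.ContMDiffRiemannianMetric 𝓘(ℝ, F) ∞ F (fun x : F => TangentSpace 𝓘(ℝ, F) x)

/-- A smooth field of inner products on a vector space, as a Riemannian metric on the manifold. -/
def riemannianMetricOfForm (form : F → F →L[ℝ] F →L[ℝ] ℝ) (contDiff : ContDiff ℝ ∞ form)
    (symm : ∀ x v w, form x v w = form x w v) (pos : ∀ x v, v ≠ 0 → 0 < form x v v)
    (bdd : ∀ x, Bornology.IsVonNBounded ℝ {v : F | form x v v < 1}) :
    SmoothMetric F where
  inner x := (form x : F →L[ℝ] F →L[ℝ] ℝ)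
  symm x v w := symm x v w
  pos x v hv := pos x v hv
  isVonNBounded x := bdd x
  contMDiff := by
    intro x
    refine (Bundle.contMDiffAt_section _).2 ?_
    refine (contDiff.contMDiff.contMDiffAt (x := x)).congr_of_eventuallyEq ?_
    refine Filter.Eventually.of_forall fun y => ?_
    ext v w
    refine (congrArg (fun p : F × (F →L[ℝ] F →L[ℝ] ℝ) => p.2 v w)
      (hom_trivializationAt_apply (RingHom.id ℝ) (F₁ := F)
        (E₁ := fun x : F => TangentSpace 𝓘(ℝ, F) x) (F₂ := F →L[ℝ] ℝ)
        (E₂ := fun x : F => TangentSpace 𝓘(ℝ, F) x →L[ℝ] ℝ) x ⟨y, form y⟩)).trans ?_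
    simp only [ContinuousLinearMap.inCoordinates, TangentBundle.symmL_model_space,
      ContinuousLinearMap.comp_apply]
    have key (L : F →L[ℝ] ℝ) : (Bundle.Trivialization.continuousLinearMapAt ℝ
        (trivializationAt (F →L[ℝ] ℝ) (fun x : F => TangentSpace 𝓘(ℝ, F) x →L[ℝ] ℝ) x) y
          (L : TangentSpace 𝓘(ℝ, F) y →L[ℝ] ℝ) : F →L[ℝ] ℝ) w = L w := by
      have hm : y ∈ (trivializationAt (F →L[ℝ] ℝ)
          (fun x : F => TangentSpace 𝓘(ℝ, F) x →L[ℝ] ℝ) x).baseSet := by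
        simp [chartAt_self_eq]
      have h1 := congrFun (Bundle.Trivialization.coe_linearMapAt_of_mem (R := ℝ) _ hm)
        (L : TangentSpace 𝓘(ℝ, F) y →L[ℝ] ℝ)
      refine (congrArg (fun M : F →L[ℝ] ℝ => M w) h1).trans ?_
      refine (congrArg (fun p : F × (F →L[ℝ] ℝ) => p.2 w)
        (hom_trivializationAt_apply (RingHom.id ℝ) (F₁ := F)
          (E₁ := fun x : F => TangentSpace 𝓘(ℝ, F) x) (F₂ := ℝ)
          (E₂ := fun _ : F => ℝ) x ⟨y, L⟩)).trans ?_
      simp only [ContinuousLinearMap.inCoordinates, TangentBundle.symmL_model_space,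
        ContinuousLinearMap.comp_apply]
      simp
      rfl
    exact key (form y v)

/-- The Riemannian distance of a Riemannian metric on a vector space, that is the infimum of the
lengths of the `C¹` paths. -/
def riemannianEDistOf (g : SmoothMetric F) (x y : F) : ℝ≥0∞ :=
  letI : Bundle.RiemannianBundle (fun x : F => TangentSpace 𝓘(ℝ, F) x) := ⟨g.toRiemannianMetric⟩
  Manifold.riemannianEDist 𝓘(ℝ, F) x y

lemma riemannianEDistOf_eq (g : SmoothMetric F) (x y : F) : riemannianEDistOf g x y =
      ⨅ (γ : Path x y) (_ : ContMDiff (𝓡∂ 1) 𝓘(ℝ, F) 1 γ), ∫⁻ t, ENNReal.ofReal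
        √(g.inner (γ t) (mfderiv (𝓡∂ 1) 𝓘(ℝ, F) γ t 1) (mfderiv (𝓡∂ 1) 𝓘(ℝ, F) γ t 1)) := by
  let : Bundle.RiemannianBundle (fun x : F => TangentSpace 𝓘(ℝ, F) x) := ⟨g.toRiemannianMetric⟩
  have h (z : F) (v : TangentSpace 𝓘(ℝ, F) z) : ‖v‖ₑ = ENNReal.ofReal √(g.inner z v v) := by
    rw [← ofReal_norm, norm_eq_sqrt_real_inner]
    rfl
  change Manifold.riemannianEDist 𝓘(ℝ, F) x y = _
  rw [Manifold.riemannianEDist]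
  simp only [h]

lemma riemannianEDistOf_self (g : SmoothMetric F) (x : F) : riemannianEDistOf g x x = 0 := by
  let : Bundle.RiemannianBundle (fun x : F => TangentSpace 𝓘(ℝ, F) x) := ⟨g.toRiemannianMetric⟩
  exact Manifold.riemannianEDist_self

lemma riemannianEDistOf_comm (g : SmoothMetric F) (x y : F) : riemannianEDistOf g x y = riemannianEDistOf g y x := by
  let : Bundle.RiemannianBundle (fun x : F => TangentSpace 𝓘(ℝ, F) x) := ⟨g.toRiemannianMetric⟩
  exact Manifold.riemannianEDist_comm

lemma riemannianEDistOf_triangle (g : SmoothMetric F) (x y z : F) :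
    riemannianEDistOf g x z ≤ riemannianEDistOf g x y + riemannianEDistOf g y z := by
  let : Bundle.RiemannianBundle (fun x : F => TangentSpace 𝓘(ℝ, F) x) := ⟨g.toRiemannianMetric⟩
  exact Manifold.riemannianEDist_triangle

/-- A pointwise comparison of two Riemannian metrics gives a comparison of the distances. -/
lemma riemannianEDistOf_le
    (g h : SmoothMetric F)
    {c : ℝ} (hc : 0 < c)
    (hgh : ∀ (x : F) (v : TangentSpace 𝓘(ℝ, F) x), g.inner x v v ≤ c ^ 2 * h.inner x v v)
    (x y : F) : riemannianEDistOf g x y ≤ ENNReal.ofReal c * riemannianEDistOf h x y := by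
  rw [riemannianEDistOf_eq, riemannianEDistOf_eq,
    ENNReal.mul_iInf_of_ne (by simpa using hc) ENNReal.ofReal_ne_top]
  refine iInf_mono fun γ => ?_
  rw [ENNReal.mul_iInf_of_ne (by simpa using hc) ENNReal.ofReal_ne_top]
  refine iInf_mono fun _ => ?_
  rw [← lintegral_const_mul' _ _ ENNReal.ofReal_ne_top]
  refine lintegral_mono fun t => ?_
  rw [← ENNReal.ofReal_mul hc.le]
  refine ENNReal.ofReal_le_ofReal (Real.sqrt_le_iff.2 ⟨by positivity, ?_⟩)
  have hpos (v : TangentSpace 𝓘(ℝ, F) (γ t)) : 0 ≤ h.inner (γ t) v v := by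
    rcases eq_or_ne v 0 with rfl | hv
    · simp
    · exact (h.pos _ v hv).le
  rw [mul_pow, Real.sq_sqrt (hpos _)]
  exact hgh _ _

lemma riemannianEDistOf_vectorSpace (x y : F) :
    riemannianEDistOf (F := F) { riemannianMetricVectorSpace F with
      contMDiff := (riemannianMetricVectorSpace F).contMDiff.of_le (by simp) } x y
      = edist x y := by
  exact (IsRiemannianManifold.out (I := 𝓘(ℝ, F)) x y).symm

end Distance

/-- A smooth Riemannian metric on `ℝⁿ`. -/
structure RiemMetric (n : ℕ) where
  form : Eucl n → Eucl n →L[ℝ] Eucl n →L[ℝ] ℝ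
  contDiff : ContDiff ℝ ∞ form
  symm : ∀ x v w, form x v w = form x w v
  pos : ∀ x v, v ≠ 0 → 0 < form x v v

namespace RiemMetric

variable {n : ℕ}

/-- `g` is invariant under the translations by `ℤⁿ`, that is, `g` is the lift to the universal cover
`ℝⁿ` of a Riemannian metric on the torus `𝕋ⁿ = ℝⁿ / ℤⁿ`. -/
def IsPeriodic (g : RiemMetric n) : Prop :=
  ∀ (k : Fin n → ℤ) (x : Eucl n), g.form (x + WithLp.toLp 2 fun i => (k i : ℝ)) = g.form x

lemma exists_bounds_on (g : RiemMetric n) {K : Set (Eucl n)} (hK : IsCompact K) :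
    ∃ α β : ℝ, 0 < α ∧ 0 < β ∧
      ∀ x ∈ K, ∀ v, (α * ‖v‖) ^ 2 ≤ g.form x v v ∧ g.form x v v ≤ (β * ‖v‖) ^ 2 := by
  have hq : Continuous fun p : Eucl n × Eucl n => g.form p.1 p.2 p.2 := by
    have := g.contDiff.continuous
    fun_prop
  have hS : IsCompact (K ×ˢ Metric.sphere (0 : Eucl n) 1) := hK.prod (isCompact_sphere _ _)
  obtain ⟨a, ha, h1⟩ := hS.exists_forall_le' hq.continuousOn (a := 0) (by
    rintro ⟨x, v⟩ ⟨-, hv⟩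
    refine g.pos x v ?_
    rintro rfl
    simp at hv)
  obtain ⟨b, h2⟩ := hS.bddAbove_image hq.continuousOn
  refine ⟨√a, √(max b 1), by positivity, by positivity, fun x hx v => ?_⟩
  rw [mul_pow, mul_pow, Real.sq_sqrt ha.le, Real.sq_sqrt (by positivity)]
  rcases eq_or_ne v 0 with rfl | hv
  · simp
  have hv' : 0 < ‖v‖ := norm_pos_iff.2 hv
  have hu : (x, ‖v‖⁻¹ • v) ∈ K ×ˢ Metric.sphere (0 : Eucl n) 1 :=
    ⟨hx, by simp [norm_smul, hv'.ne']⟩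
  have h1' := h1 _ hu
  have h2' := (h2 (mem_image_of_mem _ hu)).trans (le_max_left b 1)
  simp only [map_smul, smul_eq_mul, _root_.smul_apply] at h1' h2'
  have e : g.form x v v = ‖v‖⁻¹ * (‖v‖⁻¹ * g.form x v v) * ‖v‖ ^ 2 := by
    field_simp
  rw [e]
  exact ⟨by gcongr, by gcongr⟩

lemma IsPeriodic.exists_bounds {g : RiemMetric n} (hg : g.IsPeriodic) :
    ∃ α β : ℝ, 0 < α ∧ 0 < β ∧
      ∀ x v, (α * ‖v‖) ^ 2 ≤ g.form x v v ∧ g.form x v v ≤ (β * ‖v‖) ^ 2 := by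
  have hK : IsCompact (WithLp.toLp 2 '' (univ.pi fun _ : Fin n => Icc (0 : ℝ) 1)) :=
    (isCompact_univ_pi fun _ => isCompact_Icc).image (PiLp.continuous_toLp 2 _)
  obtain ⟨α, β, hα, hβ, h⟩ := g.exists_bounds_on hK
  refine ⟨α, β, hα, hβ, fun x v => ?_⟩
  have hx : x = WithLp.toLp 2 (fun i => Int.fract (x i)) +
      WithLp.toLp 2 (fun i => ((⌊x i⌋ : ℤ) : ℝ)) := by
    ext i
    simp
  rw [hx, hg]
  exact h _ ⟨_, fun i _ => ⟨Int.fract_nonneg _, (Int.fract_lt_one _).le⟩, rfl⟩ v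

/-- `g` as a Riemannian metric on the manifold `ℝⁿ`. -/
def toContMDiff (g : RiemMetric n) : SmoothMetric (Eucl n) :=
  riemannianMetricOfForm g.form g.contDiff g.symm g.pos fun x => by
    obtain ⟨α, β, hα, hβ, h⟩ := g.exists_bounds_on (isCompact_singleton (x := x))
    refine (NormedSpace.isVonNBounded_closedBall ℝ (Eucl n) α⁻¹).subset fun v hv => ?_
    have h1 := (h x rfl v).1
    have h2 : g.form x v v < 1 := hv
    have h3 : α * ‖v‖ ≤ 1 := by
      by_contra! hc
      nlinarith
    rw [mem_closedBall_zero_iff, ← one_div, le_div_iff₀ hα]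
    linarith

/-- The Riemannian distance `d_g`. -/
def dist (g : RiemMetric n) (x y : Eucl n) : ℝ := (riemannianEDistOf g.toContMDiff x y).toReal

/-- The rescaled distance `d_ρ(x, y) = d_g(ρ x, ρ y) / ρ`. -/
def rescaledDist (g : RiemMetric n) (ρ : ℝ) (x y : Eucl n) : ℝ := g.dist (ρ • x) (ρ • y) / ρ

lemma IsPeriodic.isBilipDist {g : RiemMetric n} (hg : g.IsPeriodic) : IsBilipDist g.dist := by
  obtain ⟨α, β, hα, hβ, h⟩ := hg.exists_bounds
  let g₀ : SmoothMetric (Eucl n) := { riemannianMetricVectorSpace (Eucl n) with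
      contMDiff := (riemannianMetricVectorSpace (Eucl n)).contMDiff.of_le (by simp) }
  have h₀ (x y : Eucl n) : riemannianEDistOf g₀ x y = edist x y := riemannianEDistOf_vectorSpace x y
  have hin (x v : Eucl n) : g₀.inner x v v = ‖v‖ ^ 2 := real_inner_self_eq_norm_sq v
  have hup (x y : Eucl n) :
      riemannianEDistOf g.toContMDiff x y ≤ ENNReal.ofReal β * edist x y := by
    rw [← h₀]
    refine riemannianEDistOf_le _ _ hβ (fun z v => ?_) x y
    have := (h z v).2
    rw [mul_pow, ← hin z v] at this
    exact this
  have hlo (x y : Eucl n) :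
      edist x y ≤ ENNReal.ofReal α⁻¹ * riemannianEDistOf g.toContMDiff x y := by
    rw [← h₀]
    refine riemannianEDistOf_le _ _ (inv_pos.2 hα) (fun z v => ?_) x y
    have h1 := (h z v).1
    rw [mul_pow, ← hin z v] at h1
    rw [inv_pow, ← div_eq_inv_mul, le_div_iff₀ (by positivity), mul_comm]
    exact h1
  have hne (x y : Eucl n) : riemannianEDistOf g.toContMDiff x y ≠ ⊤ :=
    ((hup x y).trans_lt (ENNReal.mul_lt_top ENNReal.ofReal_lt_top (edist_lt_top x y))).ne
  refine ⟨fun x => ?_, fun x y => ?_, fun x y z => ?_, α, β, hα, hβ, fun x y => ⟨?_, ?_⟩⟩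
  · simp [dist, riemannianEDistOf_self]
  · rw [dist, riemannianEDistOf_comm, dist]
  · rw [dist, dist, dist, ← ENNReal.toReal_add (hne _ _) (hne _ _)]
    exact ENNReal.toReal_mono (ENNReal.add_ne_top.2 ⟨hne _ _, hne _ _⟩)
      (riemannianEDistOf_triangle _ x y z)
  · have := ENNReal.toReal_mono (ENNReal.mul_ne_top ENNReal.ofReal_ne_top (hne x y)) (hlo x y)
    rw [ENNReal.toReal_mul, ENNReal.toReal_ofReal (by positivity), edist_dist,
      ENNReal.toReal_ofReal dist_nonneg, dist_eq_norm, ← div_eq_inv_mul, le_div_iff₀ hα] at this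
    rw [mul_comm]
    exact this
  · have := ENNReal.toReal_mono (ENNReal.mul_ne_top ENNReal.ofReal_ne_top (edist_ne_top x y))
      (hup x y)
    rwa [ENNReal.toReal_mul, ENNReal.toReal_ofReal hβ.le, edist_dist,
      ENNReal.toReal_ofReal dist_nonneg, dist_eq_norm] at this

lemma IsPeriodic.isBilipDist_rescaledDist {g : RiemMetric n} (hg : g.IsPeriodic) {ρ : ℝ}
    (hρ : 0 < ρ) : IsBilipDist (g.rescaledDist ρ) := by
  obtain ⟨α, β, hα, hβ, h⟩ := hg.isBilipDist.bilip
  refine ⟨fun x => ?_, fun x y => ?_, fun x y z => ?_, α, β, hα, hβ, fun x y => ?_⟩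
  · simp [rescaledDist, hg.isBilipDist.self]
  · rw [rescaledDist, hg.isBilipDist.comm, rescaledDist]
  · rw [rescaledDist, rescaledDist, rescaledDist, ← add_div]
    have := hg.isBilipDist.triangle (ρ • x) (ρ • y) (ρ • z)
    gcongr
  · have := h (ρ • x) (ρ • y)
    rw [← smul_sub, norm_smul, Real.norm_of_nonneg hρ.le] at this
    rw [rescaledDist, le_div_iff₀ hρ, div_le_iff₀ hρ]
    constructor <;> linarith [this.1, this.2]

/-- The Riemannian measure of `g`, with density `√det(g(eᵢ, eⱼ))` with respect to the Lebesgue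
measure. -/
def measure (g : RiemMetric n) : Measure (Eucl n) :=
  (volume : Measure (Eucl n)).withDensity fun x => ENNReal.ofReal
    √(Matrix.det (Matrix.of fun i j : Fin n =>
      g.form x (EuclideanSpace.single i 1) (EuclideanSpace.single j 1)))

instance (g : RiemMetric n) : IsLocallyFiniteMeasure g.measure := by
  refine IsLocallyFiniteMeasure.withDensity_ofReal (Real.continuous_sqrt.comp ?_)
  refine Continuous.matrix_det (continuous_matrix fun i j => ?_)
  have := g.contDiff.continuous
  simp only [Matrix.of_apply]
  fun_prop

/-- The pull-back `δ_ρ^* h` of a bilinear form `h` at `ρ x` by the homothety `δ_ρ : x ↦ ρ x`. -/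
def homothetyPullback (ρ : ℝ) (x : Eucl n) (h : Eucl n →L[ℝ] Eucl n →L[ℝ] ℝ) :
    Eucl n →L[ℝ] Eucl n →L[ℝ] ℝ :=
  h.bilinearComp (fderiv ℝ (fun y : Eucl n => ρ • y) x) (fderiv ℝ (fun y : Eucl n => ρ • y) x)

lemma smul_homothetyPullback {ρ : ℝ} (hρ : 0 < ρ) (x : Eucl n)
    (h : Eucl n →L[ℝ] Eucl n →L[ℝ] ℝ) : (1 / ρ ^ 2) • homothetyPullback ρ x h = h := by
  have h1 : fderiv ℝ (fun y : Eucl n => ρ • y) x = ρ • ContinuousLinearMap.id ℝ (Eucl n) := by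
    rw [fderiv_fun_const_smul differentiableAt_fun_id, fderiv_fun_id]
  ext v w
  have := hρ.ne'
  simp [homothetyPullback, h1]
  field_simp

/-- The rescaled metric `g_ρ = (1 / ρ²) (δ_ρ)^* g`, where `δ_ρ` is the homothety `x ↦ ρ x`. -/
def rescale (g : RiemMetric n) (ρ : ℝ) (hρ : 0 < ρ) : RiemMetric n where
  form x := (1 / ρ ^ 2) • homothetyPullback ρ x (g.form (ρ • x))
  contDiff := by
    simp only [smul_homothetyPullback hρ]
    exact g.contDiff.comp (contDiff_const_smul ρ)
  symm x v w := by
    simp only [smul_homothetyPullback hρ]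
    exact g.symm _ v w
  pos x v hv := by
    simp only [smul_homothetyPullback hρ]
    exact g.pos _ v hv

/-- The measured metric ball `(B_ρ(R), d_ρ, μ_ρ)`, where `B_ρ(R) = {x | d_ρ(0, x) ≤ R}` and `μ_ρ` is
the Riemannian measure of the rescaled metric `g_ρ`. -/
def rescaledBall (g : RiemMetric n) (hg : g.IsPeriodic) (ρ : ℝ) (hρ : 0 < ρ) (R : ℝ) :
    CompactMMSpace :=
  (hg.isBilipDist_rescaledDist hρ).closedBall (g.rescale ρ hρ).measure R

/-- `N` is the stable norm of `g`: `N x = lim d_g(0, ρ x) / ρ` as `ρ → +∞`. -/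
def IsStableNorm (g : RiemMetric n) (N : VecNorm n) : Prop :=
  ∀ x : Eucl n, Tendsto (fun ρ : ℝ => g.dist 0 (ρ • x) / ρ) atTop (𝓝 (N x))

/-- The fundamental domain `[0, 1)ⁿ` of the action of `ℤⁿ` on `ℝⁿ`. -/
def fundDomain (n : ℕ) : Set (Eucl n) :=
  ZSpan.fundamentalDomain (EuclideanSpace.basisFun (Fin n) ℝ).toBasis

/-- The multiple `μ_∞` of the Lebesgue measure that gives to the fundamental domain `D` the
mass `μ_g(D)`. -/
def limitMeasure (g : RiemMetric n) : Measure (Eucl n) :=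
  (g.measure (fundDomain n) / volume (fundDomain n)) • volume

lemma volume_fundDomain_ne_zero : (volume : Measure (Eucl n)) (fundDomain n) ≠ 0 :=
  ZSpan.measure_fundamentalDomain_ne_zero _

lemma measure_fundDomain_ne_top (μ : Measure (Eucl n)) [IsLocallyFiniteMeasure μ] :
    μ (fundDomain n) ≠ ⊤ :=
  (ZSpan.fundamentalDomain_isBounded _).measure_lt_top.ne

lemma limitMeasure_fundDomain (g : RiemMetric n) :
    g.limitMeasure (fundDomain n) = g.measure (fundDomain n) := by
  rw [limitMeasure, Measure.smul_apply, smul_eq_mul]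
  exact ENNReal.div_mul_cancel volume_fundDomain_ne_zero (measure_fundDomain_ne_top _)

instance (g : RiemMetric n) : IsFiniteMeasureOnCompacts g.limitMeasure :=
  IsFiniteMeasureOnCompacts.smul _
    (ENNReal.div_ne_top (measure_fundDomain_ne_top _) volume_fundDomain_ne_zero)

end RiemMetric

end

/-! Integer translations are isometries of `g.dist`. Every translation is an integer one followed by
a bounded one, so an arbitrary translation changes `g.dist` by at most a constant `C`
(`exists_dist_add_right_bound`). Hence `t ↦ g.dist 0 (t • x)` is subadditive up to `C`, and Fekete's
lemma gives the limit of `g.dist 0 (ρ • x) / ρ`. At scale `ρ` the defect is `C / ρ`, so the limit is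
exactly subadditive and even; the lower bi-Lipschitz bound makes it definite.

The rescaled distances are uniformly bi-Lipschitz, so convergence is uniform on compact sets, first
from the origin and then for pairs, because `d_ρ(x, y)` differs from `d_ρ(0, y - x)` by at most `C /
ρ`. The unit balls are then nearly the same set, and the radial retraction onto the ball of the norm
serves as Hausdorff approximation (`isHausdorffApprox_toBall`).

For the measures, the density of `μ_ρ` is `x ↦ θ(ρ x)` with `θ` continuous and periodic. Averaging
over the shifts `x ↦ x + s / ρ`, with `s` in the fundamental domain, replaces this oscillating
factor by its mean (`tendsto_integral_mul_comp_smul`). The indicators of the balls converge off the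
unit sphere of the norm, which is a null set. -/

/-! ### Invariance and almost invariance of the distance under translations. -/

/-- Translations that preserve a Riemannian metric do not increase the Riemannian distance. -/
lemma riemannianEDistOf_add_right_le {F : Type*} [NormedAddCommGroup F] [InnerProductSpace ℝ F]
    (g : SmoothMetric F) (k : F)
    (hk : ∀ x v : F, g.inner (x + k) v v = g.inner x v v) (x y : F) :
    riemannianEDistOf g (x + k) (y + k) ≤ riemannianEDistOf g x y := by
  rw [riemannianEDistOf_eq, riemannianEDistOf_eq]
  refine le_iInf₂ fun γ hγ => ?_
  have hT : ContMDiff 𝓘(ℝ, F) 𝓘(ℝ, F) 1 fun z : F => z + k :=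
    (contDiff_id.add contDiff_const).contMDiff
  have hc : Continuous fun z : F => z + k := by fun_prop
  refine (iInf₂_le (γ.map hc) (hT.comp hγ)).trans (lintegral_mono fun t => ?_)
  have hd : mfderiv (𝓡∂ 1) 𝓘(ℝ, F) (γ.map hc) t = mfderiv (𝓡∂ 1) 𝓘(ℝ, F) γ t := by
    have h1 := mfderiv_comp (I := 𝓡∂ 1) (I' := 𝓘(ℝ, F)) (I'' := 𝓘(ℝ, F)) t
      (hT.mdifferentiableAt one_ne_zero (x := γ t)) (hγ.mdifferentiableAt one_ne_zero (x := t))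
    refine h1.trans ?_
    rw [mfderiv_eq_fderiv, fderiv_add_const, fderiv_fun_id]
    exact ContinuousLinearMap.id_comp _
  have e := hk (γ t) (mfderiv (𝓡∂ 1) 𝓘(ℝ, F) γ t 1)
  refine le_of_eq ?_
  rw [hd]
  exact congrArg (fun r => ENNReal.ofReal √r) e

namespace RiemMetric

variable {n : ℕ} {g : RiemMetric n}

lemma IsPeriodic.dist_add_int (hg : g.IsPeriodic) (k : Fin n → ℤ) (x y : Eucl n) :
    g.dist (x + WithLp.toLp 2 fun i => (k i : ℝ)) (y + WithLp.toLp 2 fun i => (k i : ℝ)) =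
      g.dist x y := by
  have key (k : Fin n → ℤ) (x y : Eucl n) := riemannianEDistOf_add_right_le g.toContMDiff
    (WithLp.toLp 2 fun i => (k i : ℝ)) (fun x v => congrArg (fun B => B v v) (hg k x)) x y
  refine congrArg ENNReal.toReal (le_antisymm (key k x y) ?_)
  have h := key (-k) (x + WithLp.toLp 2 fun i => (k i : ℝ)) (y + WithLp.toLp 2 fun i => (k i : ℝ))
  have e : (WithLp.toLp 2 fun i => (((-k) i : ℤ) : ℝ)) =
      -(WithLp.toLp 2 fun i => (k i : ℝ) : Eucl n) := by
    ext i
    simp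
  rwa [e, add_neg_cancel_right, add_neg_cancel_right] at h

/-- Split `z` into its integer part, which acts isometrically, and its fractional part `r`, which
lies in the unit cube. Moving each of the two endpoints by `r` costs at most `β * B`, hence the
constant `2 * (β * B)`. -/
lemma IsPeriodic.exists_dist_add_right_bound (hg : g.IsPeriodic) :
    ∃ C : ℝ, 0 ≤ C ∧ ∀ x y z, |g.dist (x + z) (y + z) - g.dist x y| ≤ C := by
  obtain ⟨α, β, hα, hβ, h⟩ := hg.isBilipDist.bilip
  have hK : IsCompact (WithLp.toLp 2 '' (univ.pi fun _ : Fin n => Icc (0 : ℝ) 1)) :=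
    (isCompact_univ_pi fun _ => isCompact_Icc).image (PiLp.continuous_toLp 2 _)
  obtain ⟨B, hB0, hB⟩ := hK.isBounded.exists_pos_norm_le
  refine ⟨2 * (β * B), by positivity, fun x y z => ?_⟩
  set r : Eucl n := WithLp.toLp 2 fun i => Int.fract (z i) with hr
  have hz : z = r + WithLp.toLp 2 (fun i => ((⌊z i⌋ : ℤ) : ℝ)) := by
    ext i
    simp [hr]
  have hrB : ‖r‖ ≤ B := hB r ⟨_, fun i _ => ⟨Int.fract_nonneg _, (Int.fract_lt_one _).le⟩, rfl⟩
  rw [hz, ← add_assoc, ← add_assoc, hg.dist_add_int]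
  have hr' (w : Eucl n) : g.dist (w + r) w ≤ β * B := by
    refine (h _ _).2.trans ?_
    rw [add_sub_cancel_left]
    gcongr
  have h1 := hg.isBilipDist.triangle (x + r) x (y + r)
  have h2 := hg.isBilipDist.triangle x y (y + r)
  have h3 := hg.isBilipDist.triangle x (x + r) y
  have h4 := hg.isBilipDist.triangle (x + r) (y + r) y
  have h5 := hg.isBilipDist.comm x (x + r)
  have h6 := hg.isBilipDist.comm y (y + r)
  rw [abs_le]
  constructor <;> linarith [hr' x, hr' y]

end RiemMetric

/-! ### Existence of the stable norm. -/

/-- **Fekete's lemma** for nonnegative Lipschitz functions of a real variable that are subadditive up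
to a bounded error. -/
lemma exists_tendsto_div_of_almost_subadditive {f : ℝ → ℝ} {C β : ℝ} (hC : 0 ≤ C) (h0 : ∀ t, 0 ≤ f t)
    (hadd : ∀ s t, f (s + t) ≤ f s + f t + C) (hlip : ∀ s t, |f s - f t| ≤ β * |s - t|) :
    ∃ L, Tendsto (fun t => f t / t) atTop (𝓝 L) := by
  have hβ : 0 ≤ β := by simpa using (abs_nonneg _).trans (hlip 1 0)
  -- Adding `C` absorbs the error: `f + C` is exactly subadditive.
  have hsub : Subadditive fun k : ℕ => f k + C := fun k l => by
    have := hadd k l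
    push_cast
    linarith
  have hlim := hsub.tendsto_lim ⟨0, by
    rintro _ ⟨k, rfl⟩
    have := h0 k
    positivity⟩
  refine ⟨hsub.lim, ?_⟩
  -- Passage from integers to reals: the product equals `(f ⌊t⌋₊ + C) / t`, which differs from `f t
  -- / t` by at most `(β + C) / t`.
  have h1 : Tendsto (fun t : ℝ => (f ⌊t⌋₊ + C) / ⌊t⌋₊ * (⌊t⌋₊ / t)) atTop (𝓝 (hsub.lim * 1)) :=
    (hlim.comp tendsto_nat_floor_atTop).mul (tendsto_nat_floor_div_atTop (R := ℝ))
  rw [mul_one] at h1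
  have h2 : Tendsto (fun t : ℝ => (β + C) / t) atTop (𝓝 0) := tendsto_const_nhds.div_atTop tendsto_id
  refine h1.congr_dist (squeeze_zero' (.of_forall fun _ => dist_nonneg) ?_ h2)
  filter_upwards [eventually_ge_atTop 1] with t ht
  have ht0 : 0 < t := by linarith
  have hfl : (0 : ℝ) < ⌊t⌋₊ := by exact_mod_cast Nat.floor_pos.2 ht
  have h3 := hlip ⌊t⌋₊ t
  have h4 : |(⌊t⌋₊ : ℝ) - t| ≤ 1 := by
    rw [abs_le]
    constructor <;> linarith [Nat.floor_le ht0.le, Nat.lt_floor_add_one t]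
  rw [div_mul_div_cancel₀ hfl.ne', Real.dist_eq, ← sub_div, abs_div, abs_of_pos ht0]
  gcongr
  calc |f ⌊t⌋₊ + C - f t| = |(f ⌊t⌋₊ - f t) + C| := by ring_nf
    _ ≤ |f ⌊t⌋₊ - f t| + |C| := abs_add_le _ _
    _ ≤ β * 1 + C := by
      rw [abs_of_nonneg hC]
      gcongr
      exact h3.trans (by gcongr)
    _ = β + C := by ring

namespace IsBilipDist

variable {n : ℕ} {d : Eucl n → Eucl n → ℝ}

lemma nonneg (hd : IsBilipDist d) (x y : Eucl n) : 0 ≤ d x y := by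
  linarith [hd.self x, hd.comm x y, hd.triangle x y x]

lemma abs_sub_le (hd : IsBilipDist d) (x y z : Eucl n) : |d x y - d x z| ≤ d y z := by
  rw [abs_le]
  constructor <;> linarith [hd.triangle x y z, hd.triangle x z y, hd.comm y z]

end IsBilipDist

namespace RiemMetric

variable {n : ℕ} {g : RiemMetric n}

lemma IsPeriodic.exists_tendsto_dist_div (hg : g.IsPeriodic) (x : Eucl n) :
    ∃ L, Tendsto (fun ρ : ℝ => g.dist 0 (ρ • x) / ρ) atTop (𝓝 L) := by
  obtain ⟨C, hC, hinv⟩ := hg.exists_dist_add_right_bound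
  obtain ⟨α, β, hα, hβ, h⟩ := hg.isBilipDist.bilip
  refine exists_tendsto_div_of_almost_subadditive (β := β * ‖x‖) hC
    (fun t => hg.isBilipDist.nonneg _ _) (fun s t => ?_) fun s t => ?_
  · have h1 := (abs_le.1 (hinv 0 (t • x) (s • x))).2
    have h2 := hg.isBilipDist.triangle 0 (s • x) (t • x + s • x)
    rw [zero_add] at h1
    rw [add_smul, add_comm (s • x)]
    linarith
  · refine ((hg.isBilipDist.abs_sub_le _ _ _).trans (h _ _).2).trans_eq ?_
    rw [← sub_smul, norm_smul, Real.norm_eq_abs]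
    ring

/-- The stable norm of a periodic Riemannian metric exists. -/
lemma IsPeriodic.exists_isStableNorm (hg : g.IsPeriodic) : ∃ N : VecNorm n, g.IsStableNorm N := by
  obtain ⟨C, hC, hinv⟩ := hg.exists_dist_add_right_bound
  obtain ⟨α, β, hα, hβ, h⟩ := hg.isBilipDist.bilip
  choose N hN using hg.exists_tendsto_dist_div
  have hCρ : Tendsto (fun ρ : ℝ => C / ρ) atTop (𝓝 0) := tendsto_const_nhds.div_atTop tendsto_id
  have hzero : N 0 = 0 := tendsto_nhds_unique (hN 0) (by simp [hg.isBilipDist.self])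
  have hadd (x y : Eucl n) : N (x + y) ≤ N x + N y := by
    have h1 := ((hN x).add (hN y)).add hCρ
    rw [add_zero] at h1
    refine le_of_tendsto_of_tendsto (hN (x + y)) h1 ?_
    filter_upwards [eventually_gt_atTop 0] with ρ hρ
    rw [← add_div, ← add_div]
    gcongr
    have h1 := (abs_le.1 (hinv 0 (ρ • y) (ρ • x))).2
    have h2 := hg.isBilipDist.triangle 0 (ρ • x) (ρ • y + ρ • x)
    rw [zero_add] at h1
    rw [smul_add, add_comm (ρ • x)]
    linarith
  have hpos (t : ℝ) (ht : 0 < t) (x : Eucl n) : N (t • x) = t * N x := by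
    refine tendsto_nhds_unique (hN (t • x)) ?_
    refine (((hN x).comp (tendsto_id.atTop_mul_const ht)).const_mul t).congr' ?_
    filter_upwards [eventually_gt_atTop 0] with ρ hρ
    simp only [Function.comp_apply, id, smul_smul]
    field_simp
  -- Translating the pair `0, -(ρ • x)` by `ρ • x` gives `ρ • x, 0`, at the cost of `C`.
  have hneg (x : Eucl n) : N (-x) = N x := by
    refine tendsto_nhds_unique (hN (-x)) ((hN x).congr_dist ?_)
    refine squeeze_zero' (.of_forall fun _ => dist_nonneg) ?_ hCρ
    filter_upwards [eventually_gt_atTop 0] with ρ hρ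
    rw [Real.dist_eq, ← sub_div, abs_div, abs_of_pos hρ]
    gcongr
    have h1 := hinv 0 (-(ρ • x)) (ρ • x)
    rwa [zero_add, neg_add_cancel, hg.isBilipDist.comm, ← smul_neg] at h1
  have hsmul (t : ℝ) (x : Eucl n) : N (t • x) = ‖t‖ * N x := by
    rcases lt_trichotomy t 0 with ht | rfl | ht
    · rw [← hneg, ← neg_smul, hpos _ (neg_pos.2 ht), Real.norm_of_nonpos ht.le]
    · simp [hzero]
    · rw [hpos t ht, Real.norm_of_nonneg ht.le]
  refine ⟨⟨Seminorm.of N hadd hsmul, fun x hx => ?_⟩, hN⟩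
  have hx0 : N x = 0 := hx
  have h1 : α * ‖x‖ ≤ N x := by
    refine ge_of_tendsto (hN x) ?_
    filter_upwards [eventually_gt_atTop 0] with ρ hρ
    have h2 := (h 0 (ρ • x)).1
    rw [zero_sub, norm_neg, norm_smul, Real.norm_of_nonneg hρ.le] at h2
    rw [le_div_iff₀ hρ]
    linarith
  rw [hx0] at h1
  by_contra hne
  linarith [mul_pos hα (norm_pos_iff.2 hne)]

/-! ### Uniform convergence of the rescaled distances. -/

/-- Both sides scale linearly, so the constants of `g.dist` serve for every `ρ`. This uniformity in
`ρ`, hidden by the existential in `isBilipDist_rescaledDist`, is what the compactness arguments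
need. -/
lemma rescaledDist_bounds {α β : ℝ}
    (h : ∀ x y : Eucl n, α * ‖x - y‖ ≤ g.dist x y ∧ g.dist x y ≤ β * ‖x - y‖) {ρ : ℝ} (hρ : 0 < ρ)
    (x y : Eucl n) :
    α * ‖x - y‖ ≤ g.rescaledDist ρ x y ∧ g.rescaledDist ρ x y ≤ β * ‖x - y‖ := by
  have := h (ρ • x) (ρ • y)
  rw [← smul_sub, norm_smul, Real.norm_of_nonneg hρ.le] at this
  rw [rescaledDist, le_div_iff₀ hρ, div_le_iff₀ hρ]
  constructor <;> linarith [this.1, this.2]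

/-- The convergence to the stable norm is uniform on bounded sets. -/
lemma IsStableNorm.eventually_abs_rescaledDist_zero_sub_le {N : VecNorm n} (hN : g.IsStableNorm N)
    (hg : g.IsPeriodic) (R : ℝ) {ε : ℝ} (hε : 0 < ε) :
    ∀ᶠ ρ : ℝ in atTop, ∀ x ∈ Metric.closedBall (0 : Eucl n) R,
      |g.rescaledDist ρ 0 x - N x| ≤ ε := by
  obtain ⟨α, β, hα, hβ, h⟩ := hg.isBilipDist.bilip
  obtain ⟨α', β', hα', hβ', h'⟩ := N.isBilipDist.bilip
  -- The property of sets passes to subsets and finite unions, so by compactness it suffices to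
  -- check it near each point.
  refine (isCompact_closedBall (0 : Eucl n) R).induction_on
    (p := fun s => ∀ᶠ ρ : ℝ in atTop, ∀ x ∈ s, |g.rescaledDist ρ 0 x - N x| ≤ ε)
    (by simp) (fun s t hst ht => ht.mono fun ρ hρ x hx => hρ x (hst hx))
    (fun s t hs ht => by
      filter_upwards [hs, ht] with ρ h1 h2 x hx using hx.elim (h1 x) (h2 x)) fun x hx => ?_
  -- On a ball of this radius `d_ρ(0, ·)` and `N` together vary by at most `ε / 2`, uniformly in
  -- `ρ`; the other `ε / 2` is for convergence at the centre.
  have hδ : 0 < ε / 2 / (β + β') := by positivity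
  refine ⟨_, mem_nhdsWithin_of_mem_nhds (Metric.ball_mem_nhds x hδ), ?_⟩
  filter_upwards [eventually_gt_atTop 0, (hN x).eventually (Metric.closedBall_mem_nhds _ (half_pos hε))]
    with ρ hρ h1 y hy
  rw [mem_ball_iff_norm, lt_div_iff₀ (by positivity)] at hy
  have h2 := ((hg.isBilipDist_rescaledDist hρ).abs_sub_le 0 y x).trans (rescaledDist_bounds h hρ y x).2
  have h3 := (abs_sub_map_le_sub N.toSeminorm y x).trans (h' y x).2
  have h4 : |g.rescaledDist ρ 0 x - N x| ≤ ε / 2 := by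
    simpa [rescaledDist, Real.dist_eq] using h1
  rw [abs_le] at *
  constructor <;> linarith

/-- On bounded sets the rescaled distances converge uniformly to the distance of the stable norm. -/
lemma IsStableNorm.eventually_abs_rescaledDist_sub_le {N : VecNorm n} (hN : g.IsStableNorm N)
    (hg : g.IsPeriodic) (R : ℝ) {ε : ℝ} (hε : 0 < ε) :
    ∀ᶠ ρ : ℝ in atTop, ∀ x ∈ Metric.closedBall (0 : Eucl n) R,
      ∀ y ∈ Metric.closedBall (0 : Eucl n) R, |g.rescaledDist ρ x y - N (x - y)| ≤ ε := by
  obtain ⟨C, hC, hinv⟩ := hg.exists_dist_add_right_bound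
  have hCρ : Tendsto (fun ρ : ℝ => C / ρ) atTop (𝓝 0) := tendsto_const_nhds.div_atTop tendsto_id
  -- The radius is doubled because the estimate from the origin is applied to `y - x`.
  filter_upwards [hN.eventually_abs_rescaledDist_zero_sub_le hg (R + R) (half_pos hε),
    hCρ.eventually (ge_mem_nhds (half_pos hε)), eventually_gt_atTop 0] with ρ h1 h2 hρ x hx y hy
  rw [mem_closedBall_zero_iff] at hx hy
  have h3 := h1 (y - x) (mem_closedBall_zero_iff.2 ((norm_sub_le _ _).trans (by linarith)))
  have h4 : |g.rescaledDist ρ x y - g.rescaledDist ρ 0 (y - x)| ≤ C / ρ := by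
    rw [rescaledDist, rescaledDist, ← sub_div, abs_div, abs_of_pos hρ]
    gcongr
    simpa [smul_sub] using hinv 0 (ρ • (y - x)) (ρ • x)
  have h5 : N (x - y) = N (y - x) := map_sub_rev N.toSeminorm x y
  rw [h5]
  rw [abs_le] at *
  constructor <;> linarith

end RiemMetric

/-! ### The radial retraction as a Hausdorff approximation. -/

namespace VecNorm

variable {n : ℕ}

lemma continuous (N : VecNorm n) : Continuous N.toSeminorm := by
  obtain ⟨α, β, hα, hβ, h⟩ := N.isBilipDist.bilip
  refine (LipschitzWith.of_dist_le_mul (K := β.toNNReal) fun x y => ?_).continuous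
  rw [Real.dist_eq, dist_eq_norm, Real.coe_toNNReal _ hβ.le]
  exact (abs_sub_map_le_sub N.toSeminorm x y).trans (h x y).2

/-- The radial retraction onto the closed unit ball of the norm `N`. -/
noncomputable def retract (N : VecNorm n) (x : Eucl n) : Eucl n := (max 1 (N x))⁻¹ • x

lemma continuous_retract (N : VecNorm n) : Continuous N.retract := by
  have := N.continuous
  have h (x : Eucl n) : max 1 (N x) ≠ 0 := (lt_max_of_lt_left one_pos).ne'
  unfold retract
  fun_prop (disch := exact h _)

lemma map_retract_le (N : VecNorm n) (x : Eucl n) : N (N.retract x) ≤ 1 := by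
  have h : 0 < max 1 (N x) := lt_max_of_lt_left one_pos
  rw [retract, map_smul_eq_mul, norm_inv, Real.norm_of_nonneg h.le, inv_mul_le_iff₀ h, mul_one]
  exact le_max_right _ _

lemma retract_of_le (N : VecNorm n) {x : Eucl n} (hx : N x ≤ 1) : N.retract x = x := by
  rw [retract, max_eq_left hx, inv_one, one_smul]

lemma map_sub_retract_le (N : VecNorm n) (x : Eucl n) {η : ℝ} (hη : 0 ≤ η) (hx : N x ≤ 1 + η) :
    N (x - N.retract x) ≤ η := by
  rcases le_total (N x) 1 with h | h
  · rw [N.retract_of_le h, sub_self, map_zero]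
    exact hη
  · have h0 : 0 < N x := by linarith
    have h1 : x - N.retract x = (1 - (N x)⁻¹) • x := by
      rw [retract, max_eq_right h, sub_smul, one_smul]
    rw [h1, map_smul_eq_mul, Real.norm_of_nonneg (sub_nonneg.2 (inv_le_one_of_one_le₀ h)), sub_mul,
      inv_mul_cancel₀ h0.ne']
    linarith

/-- The radial retraction, as a map to the closed unit ball of the norm `N`. -/
noncomputable def toBall (N : VecNorm n) (μ : Measure (Eucl n)) [IsFiniteMeasureOnCompacts μ]
    (x : Eucl n) : N.closedBall μ 1 :=
  ⟨N.retract x, by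
    change N (0 - N.retract x) ≤ 1
    rw [zero_sub, map_neg_eq_map]
    exact N.map_retract_le x⟩

lemma continuous_toBall (N : VecNorm n) (μ : Measure (Eucl n)) [IsFiniteMeasureOnCompacts μ] :
    Continuous (N.toBall μ) :=
  Continuous.subtype_mk N.continuous_retract _

/-- If `d` is close to the distance of the norm `N` on a ball that contains both unit balls, then the
radial retraction is a Hausdorff approximation of the unit ball of `N` by the one of `d`. -/
lemma isHausdorffApprox_toBall (N : VecNorm n) {d : Eucl n → Eucl n → ℝ} (hd : IsBilipDist d)
    (μ ν : Measure (Eucl n)) [IsFiniteMeasureOnCompacts μ] [IsFiniteMeasureOnCompacts ν]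
    {R η : ℝ} (hη : 0 < η) (hdR : ∀ x, d 0 x ≤ 1 → ‖x‖ ≤ R) (hNR : ∀ x, N x ≤ 1 → ‖x‖ ≤ R)
    (h : ∀ x ∈ Metric.closedBall (0 : Eucl n) R, ∀ y ∈ Metric.closedBall (0 : Eucl n) R,
      |d x y - N (x - y)| ≤ η) :
    IsHausdorffApprox (3 * η) fun x : hd.closedBall μ 1 => N.toBall ν x.1 := by
  have h0 : (0 : Eucl n) ∈ Metric.closedBall (0 : Eucl n) R :=
    mem_closedBall_zero_iff.2 (hNR 0 (by simp))
  have hN0 (x : Eucl n) (hx : x ∈ Metric.closedBall (0 : Eucl n) R) : |d 0 x - N x| ≤ η := by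
    simpa [map_neg_eq_map] using h 0 h0 x hx
  refine ⟨eq_univ_of_forall fun y => ?_, fun x y => ?_⟩
  · have hy : N y.1 ≤ 1 := by
      have : N (0 - y.1) ≤ 1 := y.2
      rwa [zero_sub, map_neg_eq_map] at this
    -- A point of the `N`-ball may lie slightly outside the `d`-ball. Shrinking it by `1 - η` brings
    -- it inside and moves it by at most `η`; when `η ≥ 1` the origin is used instead.
    set t : ℝ := max 0 (1 - η) with ht
    have ht0 : 0 ≤ t := le_max_left _ _
    have ht1 : t ≤ 1 := max_le zero_le_one (by linarith)
    have hNt : N (t • y.1) ≤ t := by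
      rw [map_smul_eq_mul, Real.norm_of_nonneg ht0]
      exact mul_le_of_le_one_right ht0 hy
    have hx : d 0 (t • y.1) ≤ 1 := by
      rcases le_total 0 (1 - η) with h1 | h1
      · have := (abs_le.1 (hN0 _ (mem_closedBall_zero_iff.2 (hNR _ (hNt.trans ht1))))).2
        rw [max_eq_right h1] at ht
        linarith
      · rw [ht, max_eq_left h1, zero_smul, hd.self]
        exact zero_le_one
    refine Metric.mem_thickening_iff.2 ⟨_, ⟨⟨t • y.1, hx⟩, rfl⟩, ?_⟩
    have e : dist y (N.toBall ν (t • y.1)) = N (y.1 - N.retract (t • y.1)) := rfl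
    have e' : y.1 - t • y.1 = (1 - t) • y.1 := by rw [sub_smul, one_smul]
    refine lt_of_le_of_lt (b := η) ?_ (by linarith)
    rw [e, N.retract_of_le (hNt.trans ht1), e', map_smul_eq_mul,
      Real.norm_of_nonneg (by linarith)]
    have : 1 - η ≤ t := le_max_right _ _
    nlinarith [apply_nonneg N.toSeminorm y.1]
  -- The distortion `3 * η` is one `η` for replacing `d` by `N`, plus one for retracting each point,
  -- since the `d`-ball lies in `{N ≤ 1 + η}`.
  · have hb (x : hd.closedBall μ 1) : x.1 ∈ Metric.closedBall (0 : Eucl n) R :=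
      mem_closedBall_zero_iff.2 (hdR _ x.2)
    have hr (x : hd.closedBall μ 1) : N (x.1 - N.retract x.1) ≤ η := by
      have h1 : d 0 x.1 ≤ 1 := x.2
      have h2 := (abs_le.1 (hN0 _ (hb x))).1
      exact N.map_sub_retract_le _ hη.le (by linarith)
    have e1 : dist x y = d x.1 y.1 := rfl
    have e2 : dist (N.toBall ν x.1) (N.toBall ν y.1) = N (N.retract x.1 - N.retract y.1) := rfl
    rw [e1, e2]
    have h1 := abs_le.1 (h _ (hb x) _ (hb y))
    have h2 := abs_le.1 (abs_sub_map_le_sub N.toSeminorm (x.1 - y.1) (N.retract x.1 - N.retract y.1))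
    have h3 : N ((x.1 - y.1) - (N.retract x.1 - N.retract y.1)) ≤
        N (x.1 - N.retract x.1) + N (y.1 - N.retract y.1) := by
      rw [show (x.1 - y.1) - (N.retract x.1 - N.retract y.1) =
        (x.1 - N.retract x.1) - (y.1 - N.retract y.1) by abel]
      exact map_sub_le_add N.toSeminorm _ _
    have h4 := hr x
    have h5 := hr y
    rw [abs_le]
    constructor <;> linarith

end VecNorm

/-! ### Monotone error bounds. -/

/-- A family of functions on `(0, ∞)` that is eventually uniformly small and uniformly bounded is
dominated by a positive antitone function that tends to `0`. -/
lemma exists_antitone_bound {ι : Type*} (e : Ioi (0 : ℝ) → ι → ℝ) (M : ℝ) (hM : ∀ ρ i, e ρ i ≤ M)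
    (he : ∀ ε > 0, ∀ᶠ ρ in atTop, ∀ i, e ρ i ≤ ε) :
    ∃ η : Ioi (0 : ℝ) → ℝ, (∀ ρ, 0 < η ρ) ∧ Antitone η ∧ Tendsto η atTop (𝓝 0) ∧
      ∀ ρ i, e ρ i ≤ η ρ := by
  -- Including `0` keeps the set nonempty and its supremum nonnegative, even if `ι` is empty.
  let S (ρ : Ioi (0 : ℝ)) : Set ℝ := {r | r = 0 ∨ ∃ ρ' ≥ ρ, ∃ i, r = e ρ' i}
  have hne (ρ) : (S ρ).Nonempty := ⟨0, .inl rfl⟩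
  have hbdd (ρ) : BddAbove (S ρ) := ⟨max 0 M, by
    rintro _ (rfl | ⟨ρ', -, i, rfl⟩)
    exacts [le_max_left _ _, (hM _ _).trans (le_max_right _ _)]⟩
  have h0 (ρ) : 0 ≤ sSup (S ρ) := le_csSup (hbdd ρ) (.inl rfl)
  have hinv : Tendsto (fun ρ : Ioi (0 : ℝ) => (ρ.1)⁻¹) atTop (𝓝 0) :=
    tendsto_comp_val_Ioi_atTop.2 tendsto_inv_atTop_zero
  -- The tail supremum is antitone but may vanish; adding `ρ⁻¹` makes it positive.
  refine ⟨fun ρ => sSup (S ρ) + (ρ.1)⁻¹, fun ρ => ?_, fun ρ ρ' hρ => ?_, ?_, fun ρ i => ?_⟩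
  · have := inv_pos.2 ρ.2.out
    linarith [h0 ρ]
  · have h1 : S ρ' ⊆ S ρ := by
      rintro r (rfl | ⟨ρ'', h, i, rfl⟩)
      exacts [.inl rfl, .inr ⟨ρ'', hρ.trans h, i, rfl⟩]
    exact add_le_add (csSup_le_csSup (hbdd ρ) (hne ρ') h1) (inv_anti₀ ρ.2.out hρ)
  · suffices h : Tendsto (fun ρ => sSup (S ρ)) atTop (𝓝 0) by simpa using h.add hinv
    rw [Metric.tendsto_nhds]
    intro ε hε
    obtain ⟨ρ₀, hρ₀⟩ := eventually_atTop.1 (he (ε / 2) (half_pos hε))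
    filter_upwards [eventually_ge_atTop ρ₀] with ρ hρ
    rw [Real.dist_0_eq_abs, abs_of_nonneg (h0 ρ)]
    refine (csSup_le (hne ρ) ?_).trans_lt (half_lt_self hε)
    rintro _ (rfl | ⟨ρ', h, i, rfl⟩)
    exacts [(half_pos hε).le, hρ₀ _ (hρ.trans h) i]
  · have := inv_pos.2 ρ.2.out
    linarith [le_csSup (hbdd ρ) (.inr ⟨ρ, le_rfl, i, rfl⟩ : e ρ i ∈ S ρ)]

/-! ### Averaging of periodic functions. -/

namespace RiemMetric

variable {n : ℕ}

/-- The translate `y + D` is again a fundamental domain of `ℤⁿ`, and an invariant function has the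
same integral over any two of them. -/
lemma integral_fundDomain_add_left {θ : Eucl n → ℝ}
    (hθ : ∀ (k : Fin n → ℤ) (x : Eucl n), θ (x + WithLp.toLp 2 fun i => (k i : ℝ)) = θ x)
    (y : Eucl n) : ∫ s in fundDomain n, θ (y + s) = ∫ s in fundDomain n, θ s := by
  set b := (EuclideanSpace.basisFun (Fin n) ℝ).toBasis with hb
  have hD := ZSpan.isAddFundamentalDomain' b (volume : Measure (Eucl n))
  have : Countable (Submodule.span ℤ (range b)).toAddSubgroup :=
    inferInstanceAs (Countable (Submodule.span ℤ (range b)))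
  rw [← (measurePreserving_add_left volume y).setIntegral_image_emb (measurableEmbedding_addLeft y)]
  refine (hD.vadd_of_comm y).setIntegral_eq hD fun v x => ?_
  have hv := (b.mem_span_iff_repr_mem ℤ _).1 v.2
  choose k hk using hv
  have e : (v : Eucl n) = WithLp.toLp 2 fun i => (k i : ℝ) := by
    ext i
    have := hk i
    simp [hb] at this
    simp [this]
  rw [AddSubgroup.vadd_def, vadd_eq_add, e, add_comm, hθ]

/-- **Periodic averaging**: if the functions `H ρ` converge locally uniformly at almost every point,
then the integrals of `H ρ x * θ (ρ x)` converge to the integral of the limit times the mean of the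
periodic function `θ`. -/
lemma tendsto_integral_mul_comp_smul {θ : Eucl n → ℝ} (hθc : Continuous θ)
    (hθ : ∀ (k : Fin n → ℤ) (x : Eucl n), θ (x + WithLp.toLp 2 fun i => (k i : ℝ)) = θ x)
    {T : ℝ} (hT : ∀ x, |θ x| ≤ T)
    {H : ℝ → Eucl n → ℝ} {h : Eucl n → ℝ} (hHm : ∀ ρ > 0, Measurable (H ρ)) (hhm : Measurable h)
    {M R : ℝ} (hHM : ∀ ρ > 0, ∀ x, |H ρ x| ≤ M) (hhM : ∀ x, |h x| ≤ M)
    (hHR : ∀ ρ > 0, ∀ x, R < ‖x‖ → H ρ x = 0) (hhR : ∀ x, R < ‖x‖ → h x = 0)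
    (hlim : ∀ᵐ x, ∀ s : Eucl n, Tendsto (fun ρ : ℝ => H ρ (x + ρ⁻¹ • s)) atTop (𝓝 (h x))) :
    Tendsto (fun ρ : ℝ => ∫ x, H ρ x * θ (ρ • x)) atTop
      (𝓝 ((∫ s in fundDomain n, θ s) / volume.real (fundDomain n) * ∫ x, h x)) := by
  have hDm : MeasurableSet (fundDomain n) := ZSpan.fundamentalDomain_measurableSet _
  have hDtop := measure_fundDomain_ne_top (volume : Measure (Eucl n))
  have hV : volume.real (fundDomain n) ≠ 0 :=
    (ENNReal.toReal_pos volume_fundDomain_ne_zero hDtop).ne'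
  have : IsFiniteMeasure ((volume : Measure (Eucl n)).restrict (fundDomain n)) :=
    ⟨by rw [Measure.restrict_apply_univ]; exact hDtop.lt_top⟩
  obtain ⟨B, hB0, hB⟩ := (ZSpan.fundamentalDomain_isBounded
    (EuclideanSpace.basisFun (Fin n) ℝ).toBasis).exists_pos_norm_le
  set P := ((volume : Measure (Eucl n)).restrict (fundDomain n)).prod (volume : Measure (Eucl n))
    with hP
  have hPD : ∀ᵐ p ∂P, p.1 ∈ fundDomain n :=
    Measure.quasiMeasurePreserving_fst.ae (ae_restrict_mem hDm)
  -- Integrable majorant: for `ρ ≥ 1` and `s ∈ D` the shift `ρ⁻¹ • s` has norm at most `B`, so the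
  -- shifted functions vanish outside radius `R + B`.
  let b (c : ℝ) (x : Eucl n) : ℝ := (Metric.closedBall (0 : Eucl n) (R + B)).indicator (fun _ => c) x
  have hb (c : ℝ) : Integrable (fun p : Eucl n × Eucl n => b c p.2) P :=
    ((integrable_indicator_iff measurableSet_closedBall).2
      (integrableOn_const measure_closedBall_lt_top.ne)).comp_snd _
  have hbound {c : ℝ} {x : Eucl n} {r : ℝ} (h1 : |r| ≤ c) (h2 : R + B < ‖x‖ → r = 0) :
      |r| ≤ b c x := by
    by_cases hx : x ∈ Metric.closedBall (0 : Eucl n) (R + B)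
    · rwa [show b c x = c from indicator_of_mem hx _]
    · rw [show b c x = 0 from indicator_of_notMem hx _, h2, abs_zero]
      rwa [mem_closedBall_zero_iff, not_le] at hx
  have hFm (ρ : ℝ) (hρ : 0 < ρ) : Measurable fun p : Eucl n × Eucl n => H ρ (p.2 + ρ⁻¹ • p.1) :=
    (hHm ρ hρ).comp (by fun_prop)
  have hθm (ρ : ℝ) : Measurable fun p : Eucl n × Eucl n => θ (ρ • p.2 + p.1) :=
    Continuous.measurable (by fun_prop)
  have hFb (ρ : ℝ) (hρ : 1 ≤ ρ) : ∀ᵐ p ∂P, |H ρ (p.2 + ρ⁻¹ • p.1)| ≤ b M p.2 := by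
    filter_upwards [hPD] with p hp
    refine hbound (hHM ρ (by linarith) _) fun hx => hHR ρ (by linarith) _ ?_
    have h1 : ‖ρ⁻¹ • p.1‖ ≤ B := by
      rw [norm_smul, norm_inv, Real.norm_of_nonneg (by linarith)]
      exact (mul_le_of_le_one_left (norm_nonneg _) (inv_le_one_of_one_le₀ hρ)).trans (hB _ hp)
    have h2 := norm_sub_le (p.2 + ρ⁻¹ • p.1) (ρ⁻¹ • p.1)
    rw [add_sub_cancel_right] at h2
    linarith
  have hhb (x : Eucl n) : |h x| ≤ b M x := hbound (hhM x) fun hx => hhR x (by linarith)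
  have hF1 (ρ : ℝ) (hρ : 1 ≤ ρ) :
      Integrable (fun p : Eucl n × Eucl n => H ρ (p.2 + ρ⁻¹ • p.1) * θ (ρ • p.2 + p.1)) P :=
    ((hb M).mono' (hFm ρ (by linarith)).aestronglyMeasurable (hFb ρ hρ)).mul_bdd
      (hθm ρ).aestronglyMeasurable (.of_forall fun _ => hT _)
  have hF2 (ρ : ℝ) : Integrable (fun p : Eucl n × Eucl n => h p.2 * θ (ρ • p.2 + p.1)) P :=
    ((hb M).mono' (hhm.comp measurable_snd).aestronglyMeasurable
      (.of_forall fun p => hhb p.2)).mul_bdd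
      (hθm ρ).aestronglyMeasurable (.of_forall fun _ => hT _)
  -- For fixed `s`, the substitution `x ↦ x + ρ⁻¹ • s` leaves the `x`-integral unchanged, so
  -- integrating over `s ∈ D` only multiplies by the volume of `D`.
  have hI1 (ρ : ℝ) (hρ : 1 ≤ ρ) : ∫ p, H ρ (p.2 + ρ⁻¹ • p.1) * θ (ρ • p.2 + p.1) ∂P =
      volume.real (fundDomain n) * ∫ x, H ρ x * θ (ρ • x) := by
    rw [integral_prod _ (hF1 ρ hρ)]
    have h1 (s : Eucl n) : ∫ x, H ρ (x + ρ⁻¹ • s) * θ (ρ • x + s) = ∫ x, H ρ x * θ (ρ • x) := by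
      rw [← integral_add_right_eq_self (fun x => H ρ x * θ (ρ • x)) (ρ⁻¹ • s)]
      simp only [smul_add, smul_inv_smul₀ (by linarith : ρ ≠ 0)]
    simp only [h1]
    rw [setIntegral_const, smul_eq_mul]
  -- Here `h` does not depend on `s`, so integrating in `s` first replaces `θ (ρ • x + s)` by its
  -- integral over `D`, whatever `ρ` and `x`.
  have hI2 (ρ : ℝ) : ∫ p, h p.2 * θ (ρ • p.2 + p.1) ∂P =
      (∫ s in fundDomain n, θ s) * ∫ x, h x := by
    rw [integral_prod_symm _ (hF2 ρ)]
    simp only [integral_const_mul, integral_fundDomain_add_left hθ]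
    rw [integral_mul_const, mul_comm]
  have hdiff : Tendsto (fun ρ : ℝ => ∫ p, (H ρ (p.2 + ρ⁻¹ • p.1) - h p.2) * θ (ρ • p.2 + p.1) ∂P)
      atTop (𝓝 (∫ _, (0 : ℝ) ∂P)) := by
    refine tendsto_integral_filter_of_dominated_convergence (fun p => (b M p.2 + b M p.2) * T) ?_ ?_
      (((hb M).add (hb M)).mul_const T) ?_
    · filter_upwards [eventually_gt_atTop 0] with ρ hρ
      exact (((hFm ρ hρ).sub (hhm.comp measurable_snd)).mul (hθm ρ)).aestronglyMeasurable
    · filter_upwards [eventually_ge_atTop 1] with ρ hρ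
      filter_upwards [hFb ρ hρ] with p hp
      rw [Real.norm_eq_abs, abs_mul]
      exact mul_le_mul ((abs_sub _ _).trans (add_le_add hp (hhb _))) (hT _) (abs_nonneg _)
        (add_nonneg ((abs_nonneg _).trans hp) ((abs_nonneg _).trans hp))
    · filter_upwards [Measure.quasiMeasurePreserving_snd.ae hlim] with p hp
      have h1 : Tendsto (fun ρ : ℝ => H ρ (p.2 + ρ⁻¹ • p.1) - h p.2) atTop (𝓝 0) := by
        simpa using (hp p.1).sub_const (h p.2)
      refine squeeze_zero_norm (fun ρ => ?_) (by simpa using (h1.norm.mul_const T))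
      rw [norm_mul]
      exact mul_le_mul_of_nonneg_left (hT _) (norm_nonneg _)
  rw [integral_zero] at hdiff
  have h2 := (hdiff.add_const ((∫ s in fundDomain n, θ s) * ∫ x, h x)).div_const
    (volume.real (fundDomain n))
  rw [zero_add] at h2
  rw [div_mul_eq_mul_div]
  refine h2.congr' ?_
  filter_upwards [eventually_ge_atTop 1] with ρ hρ
  simp only [sub_mul]
  rw [integral_sub (hF1 ρ hρ) (hF2 ρ), hI1 ρ hρ, hI2 ρ, sub_add_cancel, mul_div_cancel_left₀ _ hV]

end RiemMetric

/-! ### Weak convergence of the measures. -/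

lemma IsBilipDist.integral_closedBall {n : ℕ} {d : Eucl n → Eucl n → ℝ} (hd : IsBilipDist d)
    (μ : Measure (Eucl n)) [IsFiniteMeasureOnCompacts μ] (R : ℝ) (f : Eucl n → ℝ) :
    ∫ x, f x.1 ∂(hd.closedBall μ R).measure = ∫ x in {x | d 0 x ≤ R}, f x ∂μ :=
  integral_subtype_comap (hd.isCompact_ball R).measurableSet f

/-- The unit sphere of a norm is a null set. -/
lemma VecNorm.ae_ne_one {n : ℕ} (N : VecNorm n) : ∀ᵐ x : Eucl n, N x ≠ 1 := by
  -- The frontier of a convex set is null. The unit sphere lies in it, because `t • x` leaves the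
  -- ball for every `t > 1`.
  have hc : Convex ℝ {x | N x ≤ 1} := by simpa using N.toSeminorm.convexOn.convex_le 1
  refine measure_mono_null (fun x hx => ?_) (hc.addHaar_frontier volume)
  have hx1 : N x = 1 := not_not.1 hx
  refine ⟨subset_closure hx1.le, fun hint => ?_⟩
  have ht : Tendsto (fun t : ℝ => t • x) (𝓝[>] 1) (𝓝 x) := by
    have : Tendsto (fun t : ℝ => t • x) (𝓝 1) (𝓝 ((1 : ℝ) • x)) :=
      Continuous.tendsto (by fun_prop) 1
    rw [one_smul] at this
    exact this.mono_left nhdsWithin_le_nhds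
  obtain ⟨t, h1, h2⟩ := ((ht.eventually (mem_interior_iff_mem_nhds.1 hint)).and
    self_mem_nhdsWithin).exists
  have h3 : N (t • x) ≤ 1 := h1
  have h4 : (1 : ℝ) < t := h2
  rw [map_smul_eq_mul, hx1, Real.norm_of_nonneg (by linarith)] at h3
  linarith

namespace RiemMetric

variable {n : ℕ}

/-- The density of the Riemannian measure with respect to the Lebesgue measure. -/
noncomputable def density (g : RiemMetric n) (x : Eucl n) : ℝ :=
  √(Matrix.det (Matrix.of fun i j : Fin n =>
    g.form x (EuclideanSpace.single i 1) (EuclideanSpace.single j 1)))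

lemma continuous_density (g : RiemMetric n) : Continuous g.density := by
  refine Real.continuous_sqrt.comp (Continuous.matrix_det (continuous_matrix fun i j => ?_))
  have := g.contDiff.continuous
  simp only [Matrix.of_apply]
  fun_prop

lemma measure_eq_withDensity (g : RiemMetric n) :
    g.measure = volume.withDensity fun x => ENNReal.ofReal (g.density x) := rfl

lemma density_nonneg (g : RiemMetric n) (x : Eucl n) : 0 ≤ g.density x := Real.sqrt_nonneg _

lemma IsPeriodic.density_add_int {g : RiemMetric n} (hg : g.IsPeriodic) (k : Fin n → ℤ)
    (x : Eucl n) : g.density (x + WithLp.toLp 2 fun i => (k i : ℝ)) = g.density x := by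
  rw [density, density, hg]

lemma IsPeriodic.exists_density_le {g : RiemMetric n} (hg : g.IsPeriodic) :
    ∃ T, ∀ x, |g.density x| ≤ T := by
  have hK : IsCompact (WithLp.toLp 2 '' (univ.pi fun _ : Fin n => Icc (0 : ℝ) 1)) :=
    (isCompact_univ_pi fun _ => isCompact_Icc).image (PiLp.continuous_toLp 2 _)
  obtain ⟨T, hT⟩ := hK.exists_bound_of_continuousOn g.continuous_density.continuousOn
  refine ⟨T, fun x => ?_⟩
  have hx : x = WithLp.toLp 2 (fun i => Int.fract (x i)) +
      WithLp.toLp 2 (fun i => ((⌊x i⌋ : ℤ) : ℝ)) := by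
    ext i
    simp
  rw [hx, hg.density_add_int]
  exact hT _ ⟨_, fun i _ => ⟨Int.fract_nonneg _, (Int.fract_lt_one _).le⟩, rfl⟩

lemma density_rescale (g : RiemMetric n) {ρ : ℝ} (hρ : 0 < ρ) (x : Eucl n) :
    (g.rescale ρ hρ).density x = g.density (ρ • x) := by
  simp only [density, rescale, smul_homothetyPullback hρ]

lemma setIntegral_measure (g : RiemMetric n) {s : Set (Eucl n)} (hs : MeasurableSet s)
    (f : Eucl n → ℝ) : ∫ x in s, f x ∂g.measure = ∫ x, s.indicator f x * g.density x := by
  rw [measure_eq_withDensity, setIntegral_withDensity_eq_setIntegral_toReal_smul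
    g.continuous_density.measurable.ennreal_ofReal (.of_forall fun _ => ENNReal.ofReal_lt_top) _ hs,
    ← integral_indicator hs]
  congr 1 with x
  by_cases hx : x ∈ s
  · simp [hx, ENNReal.toReal_ofReal (g.density_nonneg x), mul_comm]
  · simp [hx]

lemma toReal_measure_fundDomain (g : RiemMetric n) :
    (g.measure (fundDomain n)).toReal = ∫ s in fundDomain n, g.density s := by
  have hD : MeasurableSet (fundDomain n) := ZSpan.fundamentalDomain_measurableSet _
  rw [measure_eq_withDensity, withDensity_apply _ hD,
    integral_eq_lintegral_of_nonneg_ae (.of_forall g.density_nonneg)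
      g.continuous_density.measurable.aestronglyMeasurable]

lemma setIntegral_limitMeasure (g : RiemMetric n) {s : Set (Eucl n)} (hs : MeasurableSet s)
    (f : Eucl n → ℝ) : ∫ x in s, f x ∂g.limitMeasure =
      (∫ s in fundDomain n, g.density s) / volume.real (fundDomain n) * ∫ x, s.indicator f x := by
  rw [limitMeasure, Measure.restrict_smul, integral_smul_measure, integral_indicator hs,
    ENNReal.toReal_div, toReal_measure_fundDomain, smul_eq_mul, Measure.real]

/-- The weak convergence of the Riemannian measures of the rescaled unit balls. -/
lemma IsStableNorm.tendsto_setIntegral {g : RiemMetric n} {N : VecNorm n} (hN : g.IsStableNorm N)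
    (hg : g.IsPeriodic) {u : Eucl n → ℝ} (hu : Continuous u) {M : ℝ} (hM : ∀ x, |u x| ≤ M) :
    Tendsto (fun ρ : Ioi (0 : ℝ) =>
      ∫ x in {x | g.rescaledDist ρ 0 x ≤ 1}, u x ∂(g.rescale ρ.1 ρ.2).measure) atTop
      (𝓝 (∫ x in {x | N (0 - x) ≤ 1}, u x ∂g.limitMeasure)) := by
  obtain ⟨α, β, hα, hβ, h⟩ := hg.isBilipDist.bilip
  obtain ⟨α', β', hα', hβ', h'⟩ := N.isBilipDist.bilip
  obtain ⟨T, hT⟩ := hg.exists_density_le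
  have hM0 : 0 ≤ M := (abs_nonneg _).trans (hM 0)
  have hmeas (ρ : ℝ) (hρ : 0 < ρ) : MeasurableSet {x | g.rescaledDist ρ 0 x ≤ 1} :=
    ((hg.isBilipDist_rescaledDist hρ).isCompact_ball 1).measurableSet
  have hmeas' : MeasurableSet {x | N (0 - x) ≤ 1} := (N.isBilipDist.isCompact_ball 1).measurableSet
  have hind (s : Set (Eucl n)) (x : Eucl n) : |s.indicator u x| ≤ M := by
    by_cases hx : x ∈ s
    · rw [indicator_of_mem hx]
      exact hM x
    · rwa [indicator_of_notMem hx, abs_zero]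
  -- The radius comes from the lower bounds `α * ‖x‖ ≤ d_ρ(0, x)` and `α' * ‖x‖ ≤ N x`, so all the
  -- unit balls lie in one Euclidean ball.
  have key := tendsto_integral_mul_comp_smul g.continuous_density hg.density_add_int hT
    (H := fun ρ => {x | g.rescaledDist ρ 0 x ≤ 1}.indicator u)
    (h := {x | N (0 - x) ≤ 1}.indicator u) (R := max α⁻¹ α'⁻¹)
    (fun ρ hρ => hu.measurable.indicator (hmeas ρ hρ)) (hu.measurable.indicator hmeas')
    (fun ρ _ => hind _) (hind _) (fun ρ hρ x hx => indicator_of_notMem (fun hx' => ?_) _)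
    (fun x hx => indicator_of_notMem (fun hx' => ?_) _) ?_
  · rw [setIntegral_limitMeasure _ hmeas']
    refine (tendsto_comp_val_Ioi_atTop.2 key).congr fun ρ => ?_
    refine (integral_congr_ae (.of_forall fun x => ?_)).trans
      (setIntegral_measure _ (hmeas ρ ρ.2) u).symm
    exact congrArg _ (g.density_rescale ρ.2 x).symm
  · have h1 := (rescaledDist_bounds h hρ 0 x).1.trans hx'
    rw [zero_sub, norm_neg, ← le_div_iff₀' hα, one_div] at h1
    exact absurd (hx.trans_le h1) (not_lt.2 (le_max_left _ _))
  · have h1 := (h' 0 x).1.trans hx'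
    rw [zero_sub, norm_neg, ← le_div_iff₀' hα', one_div] at h1
    exact absurd (hx.trans_le h1) (not_lt.2 (le_max_right _ _))
  -- Since `d_ρ(0, x + ρ⁻¹ • s)` tends to `N x ≠ 1`, the point is eventually on the same side of
  -- both unit spheres, so the indicators agree.
  · filter_upwards [N.ae_ne_one] with x hx s
    have hs : Tendsto (fun ρ : ℝ => x + ρ⁻¹ • s) atTop (𝓝 x) := by
      simpa using (tendsto_inv_atTop_zero (𝕜 := ℝ)).smul_const s |>.const_add x
    have hd : Tendsto (fun ρ : ℝ => g.rescaledDist ρ 0 (x + ρ⁻¹ • s)) atTop (𝓝 (N x)) := by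
      have h1 : Tendsto (fun ρ : ℝ => g.rescaledDist ρ 0 x) atTop (𝓝 (N x)) := by
        simpa [rescaledDist] using hN x
      have h2 : Tendsto (fun ρ : ℝ => β * ‖x - (x + ρ⁻¹ • s)‖) atTop (𝓝 0) := by
        simpa using ((hs.const_sub x).norm.const_mul β)
      refine h1.congr_dist (squeeze_zero' (.of_forall fun _ => dist_nonneg) ?_ h2)
      filter_upwards [eventually_gt_atTop 0] with ρ hρ
      exact ((hg.isBilipDist_rescaledDist hρ).abs_sub_le _ _ _).trans
        (rescaledDist_bounds h hρ _ _).2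
    have hN0 : N (0 - x) = N x := by rw [zero_sub, map_neg_eq_map]
    rcases lt_or_gt_of_ne hx with hx | hx
    · rw [indicator_of_mem (s := {x | N (0 - x) ≤ 1}) (hN0.trans_le hx.le)]
      refine ((hu.tendsto x).comp hs).congr' ?_
      filter_upwards [hd.eventually (gt_mem_nhds hx)] with ρ hρ
      exact (indicator_of_mem (s := {x | g.rescaledDist ρ 0 x ≤ 1}) hρ.le u).symm
    · rw [indicator_of_notMem (s := {x | N (0 - x) ≤ 1}) (not_le.2 (hx.trans_eq hN0.symm))]
      refine tendsto_const_nhds.congr' ?_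
      filter_upwards [hd.eventually (lt_mem_nhds hx)] with ρ hρ
      exact (indicator_of_notMem (s := {x | g.rescaledDist ρ 0 x ≤ 1}) (not_le.2 hρ) u).symm

/-- On a fixed ball, the difference of the rescaled distance and the distance of the stable norm is
dominated by a positive antitone function of the scale that tends to `0`. -/
lemma IsStableNorm.exists_antitone_bound {g : RiemMetric n} {N : VecNorm n} (hN : g.IsStableNorm N)
    (hg : g.IsPeriodic) (R : ℝ) : ∃ η : Ioi (0 : ℝ) → ℝ, (∀ ρ, 0 < η ρ) ∧ Antitone η ∧
      Tendsto η atTop (𝓝 0) ∧ ∀ ρ : Ioi (0 : ℝ), ∀ x ∈ Metric.closedBall (0 : Eucl n) R,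
        ∀ y ∈ Metric.closedBall (0 : Eucl n) R, |g.rescaledDist ρ x y - N (x - y)| ≤ η ρ := by
  obtain ⟨α, β, hα, hβ, h⟩ := hg.isBilipDist.bilip
  obtain ⟨α', β', hα', hβ', h'⟩ := N.isBilipDist.bilip
  let ι := {p : Eucl n × Eucl n //
    p.1 ∈ Metric.closedBall (0 : Eucl n) R ∧ p.2 ∈ Metric.closedBall (0 : Eucl n) R}
  let e (ρ : Ioi (0 : ℝ)) (p : ι) : ℝ := |g.rescaledDist ρ p.1.1 p.1.2 - N (p.1.1 - p.1.2)|
  have hM (ρ : Ioi (0 : ℝ)) (p : ι) : e ρ p ≤ (β + β') * (R + R) := by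
    obtain ⟨⟨x, y⟩, hx, hy⟩ := p
    rw [mem_closedBall_zero_iff] at hx hy
    have h1 := (rescaledDist_bounds h ρ.2 x y).2
    have h2 := (h' x y).2
    have h3 := (hg.isBilipDist_rescaledDist ρ.2).nonneg x y
    have h4 : 0 ≤ N (x - y) := apply_nonneg N.toSeminorm _
    have h5 : (β + β') * ‖x - y‖ ≤ (β + β') * (R + R) := by
      gcongr
      exact (norm_sub_le _ _).trans (add_le_add hx hy)
    have h6 : 0 ≤ β * ‖x - y‖ := by positivity
    have h7 : 0 ≤ β' * ‖x - y‖ := by positivity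
    change |g.rescaledDist ρ x y - N (x - y)| ≤ _
    rw [abs_le]
    constructor <;> linarith
  have he (ε : ℝ) (hε : 0 < ε) : ∀ᶠ ρ in atTop, ∀ p, e ρ p ≤ ε := by
    have hval : Tendsto (fun ρ : Ioi (0 : ℝ) => (ρ : ℝ)) atTop atTop :=
      tendsto_comp_val_Ioi_atTop.2 tendsto_id
    filter_upwards [hval.eventually (hN.eventually_abs_rescaledDist_sub_le hg R hε)] with ρ hρ p
    exact hρ _ p.2.1 _ p.2.2
  obtain ⟨η, h1, h2, h3, h4⟩ := _root_.exists_antitone_bound e _ hM he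
  exact ⟨η, h1, h2, h3, fun ρ x hx y hy => h4 ρ ⟨(x, y), hx, hy⟩⟩

end RiemMetric

/-! ### Conclusion. -/

theorem mainTheorem9 (n : ℕ) (g : RiemMetric n) (hg : g.IsPeriodic) :
    ∃ N : VecNorm n, g.IsStableNorm N ∧
      MGHConverges (A := Set.Ioi (0 : ℝ)) (fun ρ => g.rescaledBall hg ρ.1 ρ.2 1)
        (N.closedBall g.limitMeasure 1) := by
  obtain ⟨N, hN⟩ := hg.exists_isStableNorm
  obtain ⟨α, β, hα, hβ, h⟩ := hg.isBilipDist.bilip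
  obtain ⟨α', β', hα', hβ', h'⟩ := N.isBilipDist.bilip
  obtain ⟨η, hη0, hη, hηlim, hηle⟩ := hN.exists_antitone_bound hg (max α⁻¹ α'⁻¹)
  refine ⟨N, hN, fun ρ => 3 * η ρ, fun ρ x => N.toBall g.limitMeasure x.1,
    fun ρ => mul_pos three_pos (hη0 ρ), fun ρ ρ' hρ => ?_, ?_, fun ρ => ?_, fun ρ => ?_, fun u => ?_⟩
  · exact mul_le_mul_of_nonneg_left (hη hρ) three_pos.le
  · simpa using hηlim.const_mul 3
  · exact ((N.continuous_toBall g.limitMeasure).comp continuous_subtype_val).measurable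
  · refine N.isHausdorffApprox_toBall (hg.isBilipDist_rescaledDist ρ.2) _ _ (hη0 ρ) (fun x hx => ?_)
      (fun x hx => ?_) (hηle ρ)
    · have h1 := (RiemMetric.rescaledDist_bounds h ρ.2 0 x).1.trans hx
      rw [zero_sub, norm_neg, ← le_div_iff₀' hα, one_div] at h1
      exact h1.trans (le_max_left _ _)
    · have h1 := (h' 0 x).1
      rw [zero_sub, map_neg_eq_map, norm_neg] at h1
      replace h1 := h1.trans hx
      rw [← le_div_iff₀' hα', one_div] at h1
      exact h1.trans (le_max_right _ _)
  · obtain ⟨M, hM⟩ := isCompact_univ.exists_bound_of_continuousOn u.continuous.continuousOn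
    have key := hN.tendsto_setIntegral hg (u.continuous.comp (N.continuous_toBall g.limitMeasure))
      (fun x => hM _ (mem_univ _))
    -- The retraction is the identity on the ball of `N`, so `u ∘ N.toBall` is a bounded continuous
    -- extension of `u` to `ℝⁿ`; the same function is integrated over every ball.
    have e : ∫ y, u y ∂(N.closedBall g.limitMeasure 1).measure =
        ∫ x in {x | N (0 - x) ≤ 1}, u (N.toBall g.limitMeasure x) ∂g.limitMeasure := by
      rw [← N.isBilipDist.integral_closedBall g.limitMeasure 1
        fun x => u (N.toBall g.limitMeasure x)]
      refine integral_congr_ae (.of_forall fun y => congrArg u (Subtype.ext ?_))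
      refine (N.retract_of_le ?_).symm
      have : N (0 - y.1) ≤ 1 := y.2
      rwa [zero_sub, map_neg_eq_map] at this
    rw [e]
    refine key.congr fun ρ => ?_
    exact ((hg.isBilipDist_rescaledDist ρ.2).integral_closedBall (g.rescale ρ.1 ρ.2).measure 1
      fun x => u (N.toBall g.limitMeasure x)).symm
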